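/- Let $A \to M$ be a smooth real vector bundle of finite rank over a smooth finite-dimensional manifold, equipped with a Lie algebroid structure: a Lie bracket $[\cdot,\cdot]$ on $\Gamma(A)$ and a vector bundle morphism $\rho : A \to TM$ (the anchor) with $\rho([X,Y]) = [\rho(X),\rho(Y)]$ and $[X, fY] = f[X,Y] + (\rho(X)f)\,Y$ for $X, Y \in \Gamma(A)$, $f \in C^\infty(M)$. For a bivector $\pi \in \Gamma(\wedge^2 A)$ let $\pi^\sharp : A^* \to A$ be the bundle morphism $\pi^\sharp\alpha = i_\alpha \pi$. The bivector $\pi$ is called non-degenerate if $\pi^\sharp$ is invertible, and Poisson if its Schouten bracket $[\pi,\pi]$ vanishes. Two Poisson bivectors are called compatible if their sum is a Poisson bivector. The Nijenhuis torsion of a $(1,1)$-tensor $N : A \to A$ is $$(\mathcal{T}N)(X,Y) = [NX,NY] - N\big([NX,Y] + [X,NY]\big) + N^2[X,Y], \qquad X, Y \in \Gamma(A).$$ Theorem. Let $\pi$ and $\pi_1$ be non-degenerate Poisson bivectors on the Lie algebroid $A$. If the $(1,1)$-tensor $N = \pi_1^\sharp \circ (\pi^\sharp)^{-1}$ has vanishing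 Nijenhuis torsion, then $\pi$ and $\pi_1$ are compatible, that is, $\pi + \pi_1$ is a Poisson bivector. -/

import Mathlib

open scoped ContDiff Manifold Topology

noncomputable section LieAlgebroids

variable {E : Type*} [NormedAddCommGroup E] [NormedSpace ℝ E]
  {M : Type*} [TopologicalSpace M] [ChartedSpace E M] [IsManifold 𝓘(ℝ, E) ∞ M]
  {F₁ : Type*} [NormedAddCommGroup F₁] [NormedSpace ℝ F₁]
  {A₁ : M → Type*} [∀ x, AddCommGroup (A₁ x)] [∀ x, Module ℝ (A₁ x)]
  [∀ x, TopologicalSpace (A₁ x)] [∀ x, IsTopologicalAddGroup (A₁ x)]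
  [∀ x, ContinuousSMul ℝ (A₁ x)]
  [TopologicalSpace (Bundle.TotalSpace F₁ A₁)] [FiberBundle F₁ A₁] [VectorBundle ℝ F₁ A₁]
  {F₂ : Type*} [NormedAddCommGroup F₂] [NormedSpace ℝ F₂]
  {A₂ : M → Type*} [∀ x, AddCommGroup (A₂ x)] [∀ x, Module ℝ (A₂ x)]
  [∀ x, TopologicalSpace (A₂ x)] [∀ x, IsTopologicalAddGroup (A₂ x)]
  [∀ x, ContinuousSMul ℝ (A₂ x)]
  [TopologicalSpace (Bundle.TotalSpace F₂ A₂)] [FiberBundle F₂ A₂] [VectorBundle ℝ F₂ A₂]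
  {F₃ : Type*} [NormedAddCommGroup F₃] [NormedSpace ℝ F₃]
  {A₃ : M → Type*} [∀ x, AddCommGroup (A₃ x)] [∀ x, Module ℝ (A₃ x)]
  [∀ x, TopologicalSpace (A₃ x)] [∀ x, IsTopologicalAddGroup (A₃ x)]
  [∀ x, ContinuousSMul ℝ (A₃ x)]
  [TopologicalSpace (Bundle.TotalSpace F₃ A₃)] [FiberBundle F₃ A₃] [VectorBundle ℝ F₃ A₃]

/-! ### Sections and vector bundle morphisms -/

/-- The product `f • X` of a smooth function and a smooth section. -/
def functionSMul (f : C^∞⟮𝓘(ℝ, E), M; ℝ⟯) (X : Cₛ^∞⟮𝓘(ℝ, E); F₁, A₁⟯) :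
    Cₛ^∞⟮𝓘(ℝ, E); F₁, A₁⟯ where
  toFun x := f x • X x
  contMDiff_toFun := f.contMDiff.smul_section X.contMDiff

/-- A smooth vector bundle morphism `φ : A₁ → A₂` over the identity, applied to a section. -/
def applySection (φ : Cₛ^∞⟮𝓘(ℝ, E); F₁ →L[ℝ] F₂, fun x => A₁ x →L[ℝ] A₂ x⟯)
    (X : Cₛ^∞⟮𝓘(ℝ, E); F₁, A₁⟯) : Cₛ^∞⟮𝓘(ℝ, E); F₂, A₂⟯ where
  toFun x := φ x (X x)
  contMDiff_toFun := φ.contMDiff.clm_bundle_apply X.contMDiff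

/-- The composition `φ ∘ ψ` of smooth vector bundle morphisms. -/
def composeSection (φ : Cₛ^∞⟮𝓘(ℝ, E); F₂ →L[ℝ] F₃, fun x => A₂ x →L[ℝ] A₃ x⟯)
    (ψ : Cₛ^∞⟮𝓘(ℝ, E); F₁ →L[ℝ] F₂, fun x => A₁ x →L[ℝ] A₂ x⟯) :
    Cₛ^∞⟮𝓘(ℝ, E); F₁ →L[ℝ] F₃, fun x => A₁ x →L[ℝ] A₃ x⟯ where
  toFun x := (φ x).comp (ψ x)
  contMDiff_toFun := by
    intro x₀
    have h₁ := (contMDiffAt_hom_bundle _).1 (φ.contMDiff x₀)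
    have h₂ := (contMDiffAt_hom_bundle _).1 (ψ.contMDiff x₀)
    refine (contMDiffAt_hom_bundle _).2 ⟨contMDiffAt_id, ?_⟩
    refine (h₁.2.clm_comp h₂.2).congr_of_eventuallyEq ?_
    have m₁ := (trivializationAt F₁ A₁ x₀).open_baseSet.mem_nhds
      (FiberBundle.mem_baseSet_trivializationAt' x₀)
    have m₂ := (trivializationAt F₂ A₂ x₀).open_baseSet.mem_nhds
      (FiberBundle.mem_baseSet_trivializationAt' x₀)
    have m₃ := (trivializationAt F₃ A₃ x₀).open_baseSet.mem_nhds
      (FiberBundle.mem_baseSet_trivializationAt' x₀)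
    filter_upwards [m₁, m₂, m₃] with x k₁ k₂ k₃
    rw [ContinuousLinearMap.inCoordinates_eq k₁ k₃, ContinuousLinearMap.inCoordinates_eq k₁ k₂,
      ContinuousLinearMap.inCoordinates_eq k₂ k₃]
    ext v
    simp only [ContinuousLinearMap.comp_apply, ContinuousLinearEquiv.coe_coe,
      ContinuousLinearEquiv.symm_apply_apply]

/-- The inverse of a smooth vector bundle morphism that is invertible in every fibre. -/
def inverseSection [CompleteSpace F₁]
    (φ : Cₛ^∞⟮𝓘(ℝ, E); F₁ →L[ℝ] F₂, fun x => A₁ x →L[ℝ] A₂ x⟯)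
    (hφ : ∀ x, (φ x).IsInvertible) :
    Cₛ^∞⟮𝓘(ℝ, E); F₂ →L[ℝ] F₁, fun x => A₂ x →L[ℝ] A₁ x⟯ where
  toFun x := (φ x).inverse
  contMDiff_toFun := by
    intro x₀
    have h₁ := (contMDiffAt_hom_bundle _).1 (φ.contMDiff x₀)
    refine (contMDiffAt_hom_bundle _).2 ⟨contMDiffAt_id, ?_⟩
    have m₁ := (trivializationAt F₁ A₁ x₀).open_baseSet.mem_nhds
      (FiberBundle.mem_baseSet_trivializationAt' x₀)
    have m₂ := (trivializationAt F₂ A₂ x₀).open_baseSet.mem_nhds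
      (FiberBundle.mem_baseSet_trivializationAt' x₀)
    have hinv : ((ContinuousLinearMap.inCoordinates F₁ A₁ F₂ A₂ x₀ x₀ x₀ x₀ (φ x₀)) :
        F₁ →L[ℝ] F₂).IsInvertible := by
      rw [ContinuousLinearMap.inCoordinates_eq (FiberBundle.mem_baseSet_trivializationAt' x₀)
        (FiberBundle.mem_baseSet_trivializationAt' x₀)]
      exact ContinuousLinearMap.isInvertible_equiv.comp
        ((hφ x₀).comp ContinuousLinearMap.isInvertible_equiv)
    have h₂ : ContDiffAt ℝ ∞ (ContinuousLinearMap.inverse : (F₁ →L[ℝ] F₂) → (F₂ →L[ℝ] F₁))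
        (ContinuousLinearMap.inCoordinates F₁ A₁ F₂ A₂ x₀ x₀ x₀ x₀ (φ x₀)) :=
      hinv.contDiffAt_map_inverse
    refine (h₂.contMDiffAt.comp x₀ h₁.2).congr_of_eventuallyEq ?_
    filter_upwards [m₁, m₂] with x k₁ k₂
    simp only [Function.comp]
    rw [ContinuousLinearMap.inCoordinates_eq k₁ k₂, ContinuousLinearMap.inCoordinates_eq k₂ k₁,
      ContinuousLinearMap.inverse_equiv_comp, ContinuousLinearMap.inverse_comp_equiv]
    ext v
    simp

end LieAlgebroids

noncomputable section LieAlgebroids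

variable {E : Type*} [NormedAddCommGroup E] [NormedSpace ℝ E]
  {M : Type*} [TopologicalSpace M] [ChartedSpace E M] [IsManifold 𝓘(ℝ, E) ∞ M]
  {F : Type*} [NormedAddCommGroup F] [NormedSpace ℝ F]
  {A : M → Type*} [∀ x, AddCommGroup (A x)] [∀ x, Module ℝ (A x)]
  [∀ x, TopologicalSpace (A x)] [∀ x, IsTopologicalAddGroup (A x)]
  [∀ x, ContinuousSMul ℝ (A x)]
  [TopologicalSpace (Bundle.TotalSpace F A)] [FiberBundle F A] [VectorBundle ℝ F A]
  [ContMDiffVectorBundle ∞ F A 𝓘(ℝ, E)]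

/-! ### Lie algebroids -/

/-- The derivative `v · f` of a function `f` at `x` along the tangent vector `v`. -/
def directionalDeriv (f : M → ℝ) (x : M) (v : TangentSpace 𝓘(ℝ, E) x) : ℝ :=
  mfderiv 𝓘(ℝ, E) 𝓘(ℝ, ℝ) f x v

variable (E F A) in
/-- A Lie algebroid structure on the smooth vector bundle `A → M` (with typical fibre `F`):
a Lie bracket on the smooth sections of `A` and a smooth vector bundle morphism `A → TM`, the
anchor, which is compatible with the brackets and satisfies the Leibniz rule. -/
structure LieAlgebroid where
  /-- The Lie bracket of sections. -/
  bracket : Cₛ^∞⟮𝓘(ℝ, E); F, A⟯ →ₗ[ℝ] Cₛ^∞⟮𝓘(ℝ, E); F, A⟯ →ₗ[ℝ] Cₛ^∞⟮𝓘(ℝ, E); F, A⟯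
  /-- The anchor. -/
  anchor : Cₛ^∞⟮𝓘(ℝ, E); F →L[ℝ] E, fun x => A x →L[ℝ] TangentSpace 𝓘(ℝ, E) x⟯
  bracket_self : ∀ X, bracket X X = 0
  jacobi : ∀ X Y Z,
    bracket X (bracket Y Z) + bracket Y (bracket Z X) + bracket Z (bracket X Y) = 0
  anchor_bracket : ∀ X Y x, anchor x (bracket X Y x) =
    VectorField.mlieBracket 𝓘(ℝ, E) (fun y => anchor y (X y)) (fun y => anchor y (Y y)) x
  leibniz : ∀ (X Y : Cₛ^∞⟮𝓘(ℝ, E); F, A⟯) (f : C^∞⟮𝓘(ℝ, E), M; ℝ⟯) (x : M),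
    bracket X (functionSMul f Y) x =
      f x • bracket X Y x + directionalDeriv f x (anchor x (X x)) • Y x

variable (E F A) in
/-- Bivectors, that is, sections `P` of `⋀² A`, given by the skew-symmetric smooth vector bundle
morphism `P♯ : A* → A`, `P♯ α = i_α P`; thus `P(α, β) = ⟨β, P♯ α⟩`. -/
structure Bivector where
  /-- The vector bundle morphism `P♯ : A* → A`. -/
  sharp : Cₛ^∞⟮𝓘(ℝ, E); (F →L[ℝ] ℝ) →L[ℝ] F, fun x => (A x →L[ℝ] ℝ) →L[ℝ] A x⟯
  skew : ∀ (x : M) (α β : A x →L[ℝ] ℝ), β (sharp x α) = -α (sharp x β)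

namespace Bivector

/-- The sum of two bivectors. -/
instance : Add (Bivector E F A) where
  add P Q :=
    { sharp := P.sharp + Q.sharp
      skew := fun x α β => by
        simp only [ContMDiffSection.coe_add, Pi.add_apply, add_apply, map_add,
          P.skew x α β, Q.skew x α β]
        ring }

/-- `P` is non-degenerate if `P♯` is an isomorphism in every fibre. -/
def Nondegenerate (P : Bivector E F A) : Prop :=
  ∀ x, (P.sharp x).IsInvertible

/-- The `(1,1)`-tensor `N = P₁♯ ∘ (P♯)⁻¹`. -/
def recursionTensor (P P₁ : Bivector E F A) (hP : P.Nondegenerate) :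
    Cₛ^∞⟮𝓘(ℝ, E); F →L[ℝ] F, fun x => A x →L[ℝ] A x⟯ :=
  composeSection P₁.sharp (inverseSection P.sharp hP)

end Bivector

namespace LieAlgebroid

/-- The value `(L_X β)(Y) = ρ(X)·⟨β, Y⟩ - ⟨β, [X, Y]⟩` on the section `Y` of the Lie derivative of
the 1-form `β` (a section of `A*`) along the section `X`. -/
def lieDerivative (L : LieAlgebroid E F A) (X : Cₛ^∞⟮𝓘(ℝ, E); F, A⟯)
    (β : Cₛ^∞⟮𝓘(ℝ, E); F →L[ℝ] ℝ, fun x => A x →L[ℝ] ℝ⟯) (Y : Cₛ^∞⟮𝓘(ℝ, E); F, A⟯)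
    (x : M) : ℝ :=
  directionalDeriv (fun y => β y (Y y)) x (L.anchor x (X x)) -
    β x (L.bracket X Y x)

/-- One summand in the Schouten bracket. -/
def schoutenTerm (L : LieAlgebroid E F A) (P Q : Bivector E F A)
    (α β γ : Cₛ^∞⟮𝓘(ℝ, E); F →L[ℝ] ℝ, fun x => A x →L[ℝ] ℝ⟯) (x : M) : ℝ :=
  L.lieDerivative (applySection P.sharp α) β (applySection Q.sharp γ) x +
    L.lieDerivative (applySection Q.sharp α) β (applySection P.sharp γ) x

/-- The Schouten bracket `[P, Q]` of two bivectors, a trivector, evaluated on 1-forms: the cyclic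
sum over `α, β, γ` of `⟨L_{P♯α} β, Q♯γ⟩ + ⟨L_{Q♯α} β, P♯γ⟩`. On decomposable bivectors this is
`[X₁ ∧ X₂, Y₁ ∧ Y₂] = ∑ i j, (-1) ^ (i + j) [X_i, Y_j] ∧ X_{3-i} ∧ Y_{3-j}`. -/
def schouten (L : LieAlgebroid E F A) (P Q : Bivector E F A)
    (α β γ : Cₛ^∞⟮𝓘(ℝ, E); F →L[ℝ] ℝ, fun x => A x →L[ℝ] ℝ⟯) (x : M) : ℝ :=
  L.schoutenTerm P Q α β γ x + L.schoutenTerm P Q β γ α x + L.schoutenTerm P Q γ α β x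

/-- A bivector `P` is Poisson if `[P, P] = 0`. -/
def IsPoisson (L : LieAlgebroid E F A) (P : Bivector E F A) : Prop :=
  ∀ α β γ x, L.schouten P P α β γ x = 0

/-- Two Poisson bivectors are compatible if their sum is a Poisson bivector. -/
def Compatible (L : LieAlgebroid E F A) (P Q : Bivector E F A) : Prop :=
  L.IsPoisson P ∧ L.IsPoisson Q ∧ L.IsPoisson (P + Q)

/-- The Nijenhuis torsion
`T N (X, Y) = [N X, N Y] - N ([N X, Y] + [X, N Y]) + N² [X, Y]` of a `(1,1)`-tensor `N`. -/
def nijenhuisTorsion (L : LieAlgebroid E F A)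
    (N : Cₛ^∞⟮𝓘(ℝ, E); F →L[ℝ] F, fun x => A x →L[ℝ] A x⟯)
    (X Y : Cₛ^∞⟮𝓘(ℝ, E); F, A⟯) : Cₛ^∞⟮𝓘(ℝ, E); F, A⟯ :=
  L.bracket (applySection N X) (applySection N Y) -
    applySection N (L.bracket (applySection N X) Y + L.bracket X (applySection N Y)) +
    applySection N (applySection N (L.bracket X Y))

end LieAlgebroid

end LieAlgebroids

set_option linter.unusedSectionVars false

noncomputable section LieAlgebroids

variable {E : Type*} [NormedAddCommGroup E] [NormedSpace ℝ E]
  {M : Type*} [TopologicalSpace M] [ChartedSpace E M] [IsManifold 𝓘(ℝ, E) ∞ M]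
  {F : Type*} [NormedAddCommGroup F] [NormedSpace ℝ F]
  {A : M → Type*} [∀ x, AddCommGroup (A x)] [∀ x, Module ℝ (A x)]
  [∀ x, TopologicalSpace (A x)] [∀ x, IsTopologicalAddGroup (A x)]
  [∀ x, ContinuousSMul ℝ (A x)]
  [TopologicalSpace (Bundle.TotalSpace F A)] [FiberBundle F A] [VectorBundle ℝ F A]
  [ContMDiffVectorBundle ∞ F A 𝓘(ℝ, E)]

/-! Write `P`, `Q` for the two bivectors and `N = Q♯ ∘ (P♯)⁻¹`. By polarization it suffices that
`[P, Q] = 0`, and this follows from the identity `[P, Q](α, β, γ) = -⟨δ, T N (P♯ α, P♯ β)⟩` with `δ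
= (Q♯)⁻¹ P♯ γ`. Indeed `N P♯ = Q♯`, and by skew-symmetry the transpose of `N` sends `δ` to `γ` and
`γ` to `η = (P♯)⁻¹ Q♯ γ`, so the pairing is `⟨δ, [Q♯ α, Q♯ β]⟩ - ⟨γ, [Q♯ α, P♯ β] + [P♯ α, Q♯ β]⟩ +
⟨η, [P♯ α, P♯ β]⟩`. The equations `[Q, Q] = 0` and `[P, P] = 0` rewrite the outer terms through `γ`
alone (`IsPoisson.pairing_bracket`), and the total is `-[P, Q](α, β, γ)`. -/

/-- The pairing of a smooth 1-form with a smooth section is a differentiable function. -/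
theorem mdifferentiableAt_pairing
    (β : Cₛ^∞⟮𝓘(ℝ, E); F →L[ℝ] ℝ, fun x => A x →L[ℝ] ℝ⟯) (Y : Cₛ^∞⟮𝓘(ℝ, E); F, A⟯) (x : M) :
    MDifferentiableAt 𝓘(ℝ, E) 𝓘(ℝ, ℝ) (fun y => β y (Y y)) x := by
  -- The function is viewed as a section of the trivial line bundle.
  have h : ContMDiff 𝓘(ℝ, E) (𝓘(ℝ, E).prod 𝓘(ℝ, ℝ)) ∞
      (fun y => Bundle.TotalSpace.mk' ℝ (E := Bundle.Trivial M ℝ) y (β y (Y y))) :=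
    β.contMDiff.clm_bundle_apply Y.contMDiff
  exact ((Bundle.contMDiffAt_section _).1 (h x)).mdifferentiableAt (by simp)

theorem directionalDeriv_add {f g : M → ℝ} {x : M}
    (hf : MDifferentiableAt 𝓘(ℝ, E) 𝓘(ℝ, ℝ) f x) (hg : MDifferentiableAt 𝓘(ℝ, E) 𝓘(ℝ, ℝ) g x)
    (v : TangentSpace 𝓘(ℝ, E) x) :
    directionalDeriv (fun y => f y + g y) x v =
      directionalDeriv f x v + directionalDeriv g x v := by
  have h := mfderiv_add hf hg
  exact congrArg (fun φ => φ v) h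

namespace Bivector

theorem applySection_add_sharp (P Q : Bivector E F A)
    (α : Cₛ^∞⟮𝓘(ℝ, E); F →L[ℝ] ℝ, fun x => A x →L[ℝ] ℝ⟯) :
    applySection (P + Q).sharp α = applySection P.sharp α + applySection Q.sharp α := rfl

/-- If `Q♯ δ = P♯ γ`, then `⟨δ, Q♯ α⟩ = ⟨γ, P♯ α⟩`. -/
theorem pairing_congr (P Q : Bivector E F A) {x : M} {δ γ : A x →L[ℝ] ℝ}
    (h : Q.sharp x δ = P.sharp x γ) (α : A x →L[ℝ] ℝ) :
    δ (Q.sharp x α) = γ (P.sharp x α) := by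
  rw [Q.skew, h, P.skew x α γ]

/-- A non-degenerate bivector identifies 1-forms with sections. -/
theorem Nondegenerate.exists_sharp_eq [CompleteSpace F] {P : Bivector E F A}
    (hP : P.Nondegenerate) (X : Cₛ^∞⟮𝓘(ℝ, E); F, A⟯) :
    ∃ α : Cₛ^∞⟮𝓘(ℝ, E); F →L[ℝ] ℝ, fun x => A x →L[ℝ] ℝ⟯, applySection P.sharp α = X :=
  ⟨applySection (inverseSection P.sharp hP) X, by
    ext x
    exact (hP x).self_apply_inverse (X x)⟩

/-- This is why the torsion is tested on sections `P♯ α`: all brackets in it become brackets of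
images under `P♯` and `Q♯`. -/
theorem recursionTensor_sharp (P Q : Bivector E F A) (hP : P.Nondegenerate)
    (α : Cₛ^∞⟮𝓘(ℝ, E); F →L[ℝ] ℝ, fun x => A x →L[ℝ] ℝ⟯) :
    applySection (P.recursionTensor Q hP) (applySection P.sharp α) = applySection Q.sharp α := by
  ext x
  exact congrArg (Q.sharp x) ((hP x).inverse_apply_self (α x))

/-- If `Q♯ δ = P♯ γ`, then `δ` composed with the recursion tensor `Q♯ ∘ (P♯)⁻¹` is `γ`. -/
theorem pairing_recursionTensor (P Q : Bivector E F A) (hP : P.Nondegenerate) {x : M}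
    {δ γ : A x →L[ℝ] ℝ} (h : Q.sharp x δ = P.sharp x γ) (v : A x) :
    δ (P.recursionTensor Q hP x v) = γ v := by
  have hv : P.sharp x ((P.sharp x).inverse v) = v := (hP x).self_apply_inverse v
  calc δ (Q.sharp x ((P.sharp x).inverse v)) = γ (P.sharp x ((P.sharp x).inverse v)) :=
        P.pairing_congr Q h _
    _ = γ v := by rw [hv]

end Bivector

namespace LieAlgebroid

variable (L : LieAlgebroid E F A)

theorem bracket_swap (X Y : Cₛ^∞⟮𝓘(ℝ, E); F, A⟯) : L.bracket X Y = -L.bracket Y X := by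
  have h := L.bracket_self (X + Y)
  simp only [map_add, LinearMap.add_apply, L.bracket_self, zero_add, add_zero] at h
  exact eq_neg_of_add_eq_zero_right h

theorem lieDerivative_add_left (X X' : Cₛ^∞⟮𝓘(ℝ, E); F, A⟯)
    (β : Cₛ^∞⟮𝓘(ℝ, E); F →L[ℝ] ℝ, fun x => A x →L[ℝ] ℝ⟯) (Y : Cₛ^∞⟮𝓘(ℝ, E); F, A⟯) (x : M) :
    L.lieDerivative (X + X') β Y x = L.lieDerivative X β Y x + L.lieDerivative X' β Y x := by
  simp only [lieDerivative, directionalDeriv, map_add, LinearMap.add_apply,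
    ContMDiffSection.coe_add, Pi.add_apply]
  exact add_sub_add_comm _ _ _ _

theorem lieDerivative_add_right (X : Cₛ^∞⟮𝓘(ℝ, E); F, A⟯)
    (β : Cₛ^∞⟮𝓘(ℝ, E); F →L[ℝ] ℝ, fun x => A x →L[ℝ] ℝ⟯) (Y Y' : Cₛ^∞⟮𝓘(ℝ, E); F, A⟯)
    (x : M) :
    L.lieDerivative X β (Y + Y') x = L.lieDerivative X β Y x + L.lieDerivative X β Y' x := by
  simp only [lieDerivative, map_add, ContMDiffSection.coe_add, Pi.add_apply,
    directionalDeriv_add (mdifferentiableAt_pairing β Y x) (mdifferentiableAt_pairing β Y' x)]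
  ring

/-- Polarization of the Schouten bracket. -/
theorem schouten_add_self (P Q : Bivector E F A)
    (α β γ : Cₛ^∞⟮𝓘(ℝ, E); F →L[ℝ] ℝ, fun x => A x →L[ℝ] ℝ⟯) (x : M) :
    L.schouten (P + Q) (P + Q) α β γ x =
      L.schouten P P α β γ x + L.schouten Q Q α β γ x + 2 * L.schouten P Q α β γ x := by
  -- `schoutenTerm` is symmetric in its two bivectors, so the mixed terms pair up into the factor 2.
  simp only [schouten, schoutenTerm, Bivector.applySection_add_sharp, lieDerivative_add_left,
    lieDerivative_add_right]
  ring

variable {L}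

/-- For a Poisson bivector `Q` and 1-forms with `Q♯ δ = P♯ γ`, the pairing `⟨δ, [Q♯ α, Q♯ β]⟩`
written in terms of `γ`. -/
theorem IsPoisson.pairing_bracket {P Q : Bivector E F A} (hQ : L.IsPoisson Q)
    {γ δ : Cₛ^∞⟮𝓘(ℝ, E); F →L[ℝ] ℝ, fun x => A x →L[ℝ] ℝ⟯}
    (h : applySection Q.sharp δ = applySection P.sharp γ)
    (α β : Cₛ^∞⟮𝓘(ℝ, E); F →L[ℝ] ℝ, fun x => A x →L[ℝ] ℝ⟯) (x : M) :
    δ x (L.bracket (applySection Q.sharp α) (applySection Q.sharp β) x) =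
      -(L.lieDerivative (applySection Q.sharp α) β (applySection P.sharp γ) x +
        directionalDeriv (fun y => γ y (applySection P.sharp α y)) x
          (L.anchor x (applySection Q.sharp β x)) +
        L.lieDerivative (applySection P.sharp γ) α (applySection Q.sharp β) x) := by
  have h₁ := hQ α β δ x
  have h₂ : (fun y => δ y (applySection Q.sharp α y)) =
      fun y => γ y (applySection P.sharp α y) := by
    funext y
    exact P.pairing_congr Q (congrArg (fun s => s y) h) (α y)
  -- In `[Q, Q](α, β, δ)` this is the only term where `δ` occurs other than through `Q♯ δ = P♯ γ`.
  have h₃ : L.lieDerivative (applySection Q.sharp β) δ (applySection Q.sharp α) x =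
      directionalDeriv (fun y => γ y (applySection P.sharp α y)) x
        (L.anchor x (applySection Q.sharp β x)) +
      δ x (L.bracket (applySection Q.sharp α) (applySection Q.sharp β) x) := by
    rw [lieDerivative, h₂, L.bracket_swap (applySection Q.sharp β)]
    simp
  simp only [schouten, schoutenTerm, h, h₃] at h₁
  linarith

/-- If the recursion tensor of two non-degenerate Poisson bivectors has vanishing Nijenhuis
torsion, then their Schouten bracket vanishes. -/
theorem schouten_eq_zero_of_nijenhuisTorsion_eq_zero [CompleteSpace F] {P Q : Bivector E F A}
    (hP : L.IsPoisson P) (hQ : L.IsPoisson Q) (hP' : P.Nondegenerate) (hQ' : Q.Nondegenerate)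
    (hN : ∀ X Y, L.nijenhuisTorsion (P.recursionTensor Q hP') X Y = 0)
    (α β γ : Cₛ^∞⟮𝓘(ℝ, E); F →L[ℝ] ℝ, fun x => A x →L[ℝ] ℝ⟯) (x : M) :
    L.schouten P Q α β γ x = 0 := by
  -- `δ` and `η` are the preimage and the image of `γ` under the transpose of `N`, as `hT` and `hT'`
  -- record.
  obtain ⟨δ, hδ⟩ := hQ'.exists_sharp_eq (applySection P.sharp γ)
  obtain ⟨η, hη⟩ := hP'.exists_sharp_eq (applySection Q.sharp γ)
  have hδx : Q.sharp x (δ x) = P.sharp x (γ x) := congrArg (fun s => s x) hδ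
  have hηx : Q.sharp x (γ x) = P.sharp x (η x) := (congrArg (fun s => s x) hη).symm
  have hT : ∀ v, δ x (applySection (P.recursionTensor Q hP') v x) = γ x (v x) :=
    fun v => P.pairing_recursionTensor Q hP' hδx (v x)
  have hT' : ∀ v, γ x (applySection (P.recursionTensor Q hP') v x) = η x (v x) :=
    fun v => P.pairing_recursionTensor Q hP' hηx (v x)
  have h := congrArg (fun s => δ x (s x)) (hN (applySection P.sharp α) (applySection P.sharp β))
  simp only [nijenhuisTorsion, Bivector.recursionTensor_sharp, ContMDiffSection.coe_add,
    ContMDiffSection.coe_sub, ContMDiffSection.coe_zero, Pi.add_apply, Pi.sub_apply,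
    Pi.zero_apply, map_add, map_sub, map_zero, hT, hT'] at h
  rw [hQ.pairing_bracket hδ, hP.pairing_bracket hη] at h
  -- `h₁` and `h₂` extract the mixed brackets paired with `γ` from the two terms of `[P, Q]` that
  -- differentiate `γ`; their anchor terms match those from `pairing_bracket`.
  have h₁ : L.lieDerivative (applySection P.sharp β) γ (applySection Q.sharp α) x =
      directionalDeriv (fun y => γ y (applySection Q.sharp α y)) x
        (L.anchor x (applySection P.sharp β x)) +
      γ x (L.bracket (applySection Q.sharp α) (applySection P.sharp β) x) := by
    rw [lieDerivative, L.bracket_swap (applySection P.sharp β)]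
    simp
  have h₂ : L.lieDerivative (applySection Q.sharp β) γ (applySection P.sharp α) x =
      directionalDeriv (fun y => γ y (applySection P.sharp α y)) x
        (L.anchor x (applySection Q.sharp β x)) +
      γ x (L.bracket (applySection P.sharp α) (applySection Q.sharp β) x) := by
    rw [lieDerivative, L.bracket_swap (applySection Q.sharp β)]
    simp
  simp only [schouten, schoutenTerm, h₁, h₂]
  linarith

end LieAlgebroid

end LieAlgebroids

theorem mainTheorem7
    {E : Type*} [NormedAddCommGroup E] [NormedSpace ℝ E] [FiniteDimensional ℝ E]
    {M : Type*} [TopologicalSpace M] [T2Space M] [ParacompactSpace M]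
    [ChartedSpace E M] [IsManifold 𝓘(ℝ, E) ∞ M]
    {F : Type*} [NormedAddCommGroup F] [NormedSpace ℝ F] [FiniteDimensional ℝ F]
    {A : M → Type*} [∀ x, AddCommGroup (A x)] [∀ x, Module ℝ (A x)]
    [∀ x, TopologicalSpace (A x)] [∀ x, IsTopologicalAddGroup (A x)]
    [∀ x, ContinuousSMul ℝ (A x)]
    [TopologicalSpace (Bundle.TotalSpace F A)] [FiberBundle F A] [VectorBundle ℝ F A]
    [ContMDiffVectorBundle ∞ F A 𝓘(ℝ, E)]
    (L : LieAlgebroid E F A) (π π₁ : Bivector E F A)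
    (hπ : L.IsPoisson π) (hπ₁ : L.IsPoisson π₁)
    (hπ_nondeg : π.Nondegenerate) (hπ₁_nondeg : π₁.Nondegenerate)
    (hN : ∀ X Y, L.nijenhuisTorsion (π.recursionTensor π₁ hπ_nondeg) X Y = 0) :
    L.Compatible π π₁ := by
  have : CompleteSpace F := FiniteDimensional.complete ℝ F
  refine ⟨hπ, hπ₁, fun α β γ x => ?_⟩
  rw [L.schouten_add_self, hπ, hπ₁,
    LieAlgebroid.schouten_eq_zero_of_nijenhuisTorsion_eq_zero hπ hπ₁ hπ_nondeg hπ₁_nondeg hN]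
  simp
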